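/- **Conventions.** Let $S$ be a semigroup (not necessarily with an identity). A left $S$-module is an abelian group $A$ together with a multiplicative map $S\to\mathrm{End}(A)$. For $n\ge 0$ let $C^n(S,A)$ be the group of all maps $f:S^n\to A$ (so $C^0(S,A)=A$), with coboundary $$\partial^n f(x_1,\dots,x_{n+1})=x_1f(x_2,\dots,x_{n+1})+\sum_{i=1}^n(-1)^i f(x_1,\dots,x_ix_{i+1},\dots,x_{n+1})+(-1)^{n+1}f(x_1,\dots,x_n),$$ and let $H^n(S,A)=\operatorname{Ker}\partial^n/\operatorname{Im}\partial^{n-1}$ be the Eilenberg–MacLane cohomology groups ($\operatorname{Im}\partial^{-1}=0$). A subset $W\subseteq S$ is a *root* of $S$ if $S$ is generated by $W$ with defining relations of the form $xy=z$, where $x,y,z\in W$. For such $W$ let $W_n$ be the set of $n$-tuples $(x_1,\dots,x_n)$ of elements of $S$ with $x_ix_{i+1}\cdots x_j\in W$ for all $1\le i\le j\le n$, and let $C^n(S,W,A)$ be the group of all maps $W_n\to A$ (so $C^0(S,W,A)=A$). With the coboundary given by the same formula, $H^n(S,W,A)$ denotes the $n$-th cohomology group of this complex (the *partial cohomology*).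 Restriction of cochains from $S^n$ to $W_n$ induces homomorphisms $\theta^n_W:H^n(S,A)\to H^n(S,W,A)$. A *reduced decomposition* of $x\in S$ is an expression $x=x_1\cdots x_k$ with $k\ge1$, all $x_i\in W$, and $x_ix_{i+1}\cdots x_j\notin W$ for all $1\le i<j\le k$ (for $x\in W$ the only one is $x$ itself, with $k=1$). A root $W$ is *canonic* if every element of $S$ has a unique reduced decomposition. A root $W$ is a *$J$-root* if, for all $x,y,z\in W$, $xy=x$ and $yz=z$ imply $xz\in W$. **Theorem.** (1) If $W$ is a canonic $J$-root of a semigroup $S$, then for every left $S$-module $A$ and every $n\ge 0$ the map $\theta^n_W:H^n(S,A)\to H^n(S,W,A)$ is an isomorphism. (2) Let $T*U$ be the free product (coproduct in the category of semigroups) of semigroups $T$ and $U$. For every left $(T*U)$-module $A$ and every $n\ge 2$, the homomorphism $H^n(T*U,A)\to H^n(T,A)\oplus H^n(U,A)$ induced by the embeddings of $T$ and $U$ in $T*U$ is an isomorphism. -/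

import Mathlib

/-! A left module over a semigroup `S` (not necessarily with an identity) is an abelian group `A`
with a multiplicative map `ρ : S →ₙ* AddMonoid.End A`. -/

universe u v w

namespace PartialCoh

section Semigroups

variable {S : Type u} [Semigroup S]

/-- For `x = (x₀, …, x_{n-1})`, the product `x_i x_{i+1} ⋯ x_{i+m}` of consecutive entries. -/
def segProd {n : ℕ} (x : Fin n → S) (i : ℕ) : (m : ℕ) → i + m < n → S
  | 0, h => x ⟨i, h⟩
  | m + 1, h => segProd x i m (by omega) * x ⟨i + m + 1, h⟩

/-- The set `W_n` of all `n`-tuples such that every product of consecutive entries is in `W`. -/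
def tuples (W : Set S) (n : ℕ) : Set (Fin n → S) :=
  {x | ∀ (i m : ℕ) (h : i + m < n), segProd x i m h ∈ W}

/-- The relations `x y = z` (with `x, y, z ∈ W`) that hold in `S`, as relations between words. -/
def rootRel (W : Set S) (a b : FreeSemigroup W) : Prop :=
  ∃ x y z : W, (x : S) * (y : S) = (z : S) ∧
    a = FreeSemigroup.of x * FreeSemigroup.of y ∧ b = FreeSemigroup.of z

/-- The canonical homomorphism to `S` from the free semigroup on the set `W`. -/
def evalWord (W : Set S) : FreeSemigroup W →ₙ* S :=
  FreeSemigroup.lift (fun x : W => (x : S))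

/-- `W` is a root of `S`: `S` is generated by `W` with defining relations of the form `x y = z`,
`x, y, z ∈ W`. -/
def IsRoot (W : Set S) : Prop :=
  Function.Surjective (evalWord W) ∧ Con.ker (evalWord W) = conGen (rootRel W)

/-- `s = x₀ ⋯ x_k` is a reduced decomposition: all factors are in `W`, and no product of two or
more consecutive factors is in `W`. (For `s ∈ W` this forces `k = 0` and `x₀ = s`.) -/
def IsReducedDecomposition (W : Set S) (s : S) {k : ℕ} (x : Fin (k + 1) → S) : Prop :=
  (∀ i, x i ∈ W) ∧ segProd x 0 k (by omega) = s ∧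
    ∀ (i m : ℕ) (h : i + m < k + 1), 0 < m → segProd x i m h ∉ W

/-- Every element of `S` has a unique reduced decomposition (of any length). -/
def IsCanonic (W : Set S) : Prop :=
  ∀ s : S, ∃! d : (Σ k : ℕ, Fin (k + 1) → S), IsReducedDecomposition W s d.2

/-- The additional condition on a root to be a `J`-root. -/
def IsJ (W : Set S) : Prop :=
  ∀ x ∈ W, ∀ y ∈ W, ∀ z ∈ W, x * y = x → y * z = z → x * z ∈ W

theorem segProd_tail {n : ℕ} (x : Fin (n + 1) → S) (i m : ℕ) (h : i + m < n) :
    segProd (Fin.tail x) i m h = segProd x (i + 1) m (by omega) := by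
  induction m with
  | zero => rfl
  | succ m ih =>
    simp only [segProd, ih]
    congr 1
    change x _ = x _
    congr 1
    simp only [Fin.succ_mk, Fin.mk.injEq]
    omega

theorem segProd_init {n : ℕ} (x : Fin (n + 1) → S) (i m : ℕ) (h : i + m < n) :
    segProd (Fin.init x) i m h = segProd x i m (by omega) := by
  induction m with
  | zero => rfl
  | succ m ih =>
    simp only [segProd, ih]
    rfl

theorem segProd_contractNth {n : ℕ} (x : Fin (n + 1) → S) (j : Fin n) (i m : ℕ)
    (h : i + m < n) :
    segProd (Fin.contractNth j.castSucc (· * ·) x) i m h =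
      if (j : ℕ) < i then segProd x (i + 1) m (by omega)
      else if i + m < j then segProd x i m (by omega)
      else segProd x i (m + 1) (by omega) := by
  induction m with
  | zero =>
    rcases lt_trichotomy i (j : ℕ) with hj | hj | hj
    · rw [if_neg (by omega), if_pos (by omega)]
      exact Fin.contractNth_apply_of_lt _ _ _ _ (by simpa using hj)
    · rw [if_neg (by omega), if_neg (by omega)]
      exact Fin.contractNth_apply_of_eq _ _ _ _ (by simpa using hj)
    · rw [if_pos hj]
      exact Fin.contractNth_apply_of_gt _ _ _ _ (by simpa using hj)
  | succ m ih =>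
    rw [segProd, ih]
    rcases lt_trichotomy (i + m + 1) (j : ℕ) with hj | hj | hj
    · rw [if_neg (by omega), if_pos (by omega), if_neg (by omega), if_pos (by omega),
        Fin.contractNth_apply_of_lt _ _ _ _ (by simpa using hj)]
      rfl
    · rw [if_neg (by omega), if_pos (by omega), if_neg (by omega), if_neg (by omega),
        Fin.contractNth_apply_of_eq _ _ _ _ (by simpa using hj)]
      simp only [segProd, mul_assoc]
      rfl
    · rw [Fin.contractNth_apply_of_gt _ _ _ _ (by simpa using hj)]
      by_cases hi : (j : ℕ) < i
      · rw [if_pos hi, if_pos hi, segProd]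
        congr 2
        simp only [Fin.succ_mk, Fin.mk.injEq]
        omega
      · rw [if_neg hi, if_neg (by omega), if_neg hi, if_neg (by omega)]
        rfl

theorem tail_mem {W : Set S} {n : ℕ} {x : Fin (n + 1) → S} (hx : x ∈ tuples W (n + 1)) :
    Fin.tail x ∈ tuples W n := fun i m h => by
  rw [segProd_tail]
  exact hx _ _ _

theorem init_mem {W : Set S} {n : ℕ} {x : Fin (n + 1) → S} (hx : x ∈ tuples W (n + 1)) :
    (Fin.init x : Fin n → S) ∈ tuples W n := fun i m h => by
  rw [segProd_init]
  exact hx _ _ _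

theorem contractNth_mem {W : Set S} {n : ℕ} {x : Fin (n + 1) → S}
    (hx : x ∈ tuples W (n + 1)) (j : Fin n) :
    Fin.contractNth j.castSucc (· * ·) x ∈ tuples W n := fun i m h => by
  rw [segProd_contractNth]
  split_ifs <;> exact hx _ _ _

end Semigroups

section Cohomology

variable {S : Type u} [Semigroup S] {A : Type v} [AddCommGroup A]

/-- The coboundary `∂ⁿ : Cⁿ(S, A) → Cⁿ⁺¹(S, A)`, where `Cⁿ(S, A)` is the group of all maps from
`Sⁿ` to `A`. Here `Fin.contractNth j` multiplies the entries number `j` and `j + 1` (counted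
from `0`). -/
def coboundary (ρ : S →ₙ* AddMonoid.End A) (n : ℕ) :
    ((Fin n → S) → A) →+ ((Fin (n + 1) → S) → A) where
  toFun f x := ρ (x 0) (f (Fin.tail x)) +
    ∑ j : Fin n, (-1 : ℤ) ^ ((j : ℕ) + 1) • f (Fin.contractNth j.castSucc (· * ·) x) +
    (-1 : ℤ) ^ (n + 1) • f (Fin.init x)
  map_zero' := by
    funext x
    simp
  map_add' f g := by
    funext x
    simp only [Pi.add_apply, map_add, smul_add, Finset.sum_add_distrib]
    abel

/-- The cocycles `Zⁿ(S, A)`. -/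
def cocycles (ρ : S →ₙ* AddMonoid.End A) (n : ℕ) : AddSubgroup ((Fin n → S) → A) :=
  (coboundary ρ n).ker

/-- The coboundaries `Bⁿ(S, A)`. -/
def coboundaries (ρ : S →ₙ* AddMonoid.End A) : (n : ℕ) → AddSubgroup ((Fin n → S) → A)
  | 0 => ⊥
  | n + 1 => (coboundary ρ n).range

/-- The Eilenberg–MacLane cohomology group `Hⁿ(S, A) = Zⁿ(S, A) / Bⁿ(S, A)`. -/
abbrev Cohomology (ρ : S →ₙ* AddMonoid.End A) (n : ℕ) : Type (max u v) :=
  cocycles ρ n ⧸ (coboundaries ρ n).addSubgroupOf (cocycles ρ n)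

/-- The coboundary `∂ⁿ : Cⁿ(S, W, A) → Cⁿ⁺¹(S, W, A)` on partial cochains, given by the same
formula, where `Cⁿ(S, W, A)` is the group of all maps from `W_n` to `A`. -/
def partialCoboundary (W : Set S) (ρ : S →ₙ* AddMonoid.End A) (n : ℕ) :
    (tuples W n → A) →+ (tuples W (n + 1) → A) where
  toFun f x := ρ (x.1 0) (f ⟨Fin.tail x.1, tail_mem x.2⟩) +
    ∑ j : Fin n, (-1 : ℤ) ^ ((j : ℕ) + 1) •
      f ⟨Fin.contractNth j.castSucc (· * ·) x.1, contractNth_mem x.2 j⟩ +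
    (-1 : ℤ) ^ (n + 1) • f ⟨Fin.init x.1, init_mem x.2⟩
  map_zero' := by
    funext x
    simp
  map_add' f g := by
    funext x
    simp only [Pi.add_apply, map_add, smul_add, Finset.sum_add_distrib]
    abel

/-- The partial cocycles `Zⁿ(S, W, A)`. -/
def partialCocycles (W : Set S) (ρ : S →ₙ* AddMonoid.End A) (n : ℕ) :
    AddSubgroup (tuples W n → A) :=
  (partialCoboundary W ρ n).ker

/-- The partial coboundaries `Bⁿ(S, W, A)`. -/
def partialCoboundaries (W : Set S) (ρ : S →ₙ* AddMonoid.End A) :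
    (n : ℕ) → AddSubgroup (tuples W n → A)
  | 0 => ⊥
  | n + 1 => (partialCoboundary W ρ n).range

/-- The partial cohomology group `Hⁿ(S, W, A)`. -/
abbrev PartialCohomology (W : Set S) (ρ : S →ₙ* AddMonoid.End A) (n : ℕ) : Type (max u v) :=
  partialCocycles W ρ n ⧸ (partialCoboundaries W ρ n).addSubgroupOf (partialCocycles W ρ n)

/-- Restriction of cochains from `Sⁿ` to `W_n`. -/
def cochainRestrict (W : Set S) (A : Type v) [AddCommGroup A] (n : ℕ) :
    ((Fin n → S) → A) →+ (tuples W n → A) where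
  toFun f x := f x.1
  map_zero' := rfl
  map_add' _ _ := rfl

theorem cochainRestrict_coboundary (W : Set S) (ρ : S →ₙ* AddMonoid.End A) (n : ℕ)
    (f : (Fin n → S) → A) :
    cochainRestrict W A (n + 1) (coboundary ρ n f) =
      partialCoboundary W ρ n (cochainRestrict W A n f) := rfl

/-- Restriction of cocycles from `Sⁿ` to `W_n`. -/
def cocycleRestrict (W : Set S) (ρ : S →ₙ* AddMonoid.End A) (n : ℕ) :
    cocycles ρ n →+ partialCocycles W ρ n :=
  ((cochainRestrict W A n).comp (cocycles ρ n).subtype).codRestrict (partialCocycles W ρ n)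
    fun f => by
      change partialCoboundary W ρ n (cochainRestrict W A n f.1) = 0
      rw [← cochainRestrict_coboundary, show coboundary ρ n f.1 = 0 from f.2, map_zero]

/-- The homomorphism `θⁿ_W : Hⁿ(S, A) → Hⁿ(S, W, A)` induced by the embedding of `W` in `S`. -/
def theta (W : Set S) (ρ : S →ₙ* AddMonoid.End A) (n : ℕ) :
    Cohomology ρ n →+ PartialCohomology W ρ n :=
  QuotientAddGroup.map _ _ (cocycleRestrict W ρ n) fun f hf => by
    change cochainRestrict W A n f.1 ∈ partialCoboundaries W ρ n
    change f.1 ∈ coboundaries ρ n at hf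
    cases n with
    | zero =>
      have h0 : f.1 = 0 := hf
      rw [h0, map_zero]
      exact zero_mem _
    | succ n =>
      obtain ⟨g, hg⟩ := hf
      exact ⟨cochainRestrict W A n g, by rw [← cochainRestrict_coboundary, hg]⟩

/-- Pull-back of cochains along a homomorphism `φ : T → S`. -/
def cochainPullback {T : Type w} [Semigroup T] (φ : T →ₙ* S) (A : Type v) [AddCommGroup A]
    (n : ℕ) : ((Fin n → S) → A) →+ ((Fin n → T) → A) where
  toFun f x := f (fun i => φ (x i))
  map_zero' := rfl
  map_add' _ _ := rfl

theorem cochainPullback_coboundary {T : Type w} [Semigroup T] (φ : T →ₙ* S)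
    (ρ : S →ₙ* AddMonoid.End A) (n : ℕ) (f : (Fin n → S) → A) :
    cochainPullback φ A (n + 1) (coboundary ρ n f) =
      coboundary (ρ.comp φ) n (cochainPullback φ A n f) := by
  have key : ∀ (x : Fin (n + 1) → T) (j : Fin n),
      Fin.contractNth j.castSucc (· * ·) (fun i => φ (x i)) =
        fun i => φ (Fin.contractNth j.castSucc (· * ·) x i) := by
    intro x j
    funext i
    simp only [Fin.contractNth]
    split_ifs <;> simp
  funext x
  change ρ (φ (x 0)) _ + ∑ j : Fin n, _ + _ = ρ (φ (x 0)) _ + ∑ j : Fin n, _ + _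
  simp only [key]
  rfl

/-- Pull-back of cocycles along a homomorphism `φ : T → S`. -/
def cocyclePullback {T : Type w} [Semigroup T] (φ : T →ₙ* S) (ρ : S →ₙ* AddMonoid.End A)
    (n : ℕ) : cocycles ρ n →+ cocycles (ρ.comp φ) n :=
  ((cochainPullback φ A n).comp (cocycles ρ n).subtype).codRestrict (cocycles (ρ.comp φ) n)
    fun f => by
      change coboundary (ρ.comp φ) n (cochainPullback φ A n f.1) = 0
      rw [← cochainPullback_coboundary, show coboundary ρ n f.1 = 0 from f.2, map_zero]

/-- The homomorphism `Hⁿ(S, A) → Hⁿ(T, A)` induced by a homomorphism `φ : T → S`, where `T` acts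
on `A` through `φ`. -/
def cohomologyPullback {T : Type w} [Semigroup T] (φ : T →ₙ* S) (ρ : S →ₙ* AddMonoid.End A)
    (n : ℕ) : Cohomology ρ n →+ Cohomology (ρ.comp φ) n :=
  QuotientAddGroup.map _ _ (cocyclePullback φ ρ n) fun f hf => by
    change cochainPullback φ A n f.1 ∈ coboundaries (ρ.comp φ) n
    change f.1 ∈ coboundaries ρ n at hf
    cases n with
    | zero =>
      have h0 : f.1 = 0 := hf
      rw [h0, map_zero]
      exact zero_mem _
    | succ n =>
      obtain ⟨g, hg⟩ := hf
      exact ⟨cochainPullback φ A n g, by rw [← cochainPullback_coboundary, hg]⟩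

end Cohomology

section FreeProduct

variable (T : Type u) (U : Type w) [Semigroup T] [Semigroup U]

/-- The relations of the free product: products inside `T` and inside `U` are as given. -/
inductive FreeProductRel : FreeSemigroup (T ⊕ U) → FreeSemigroup (T ⊕ U) → Prop
  | left (t t' : T) : FreeProductRel
      (FreeSemigroup.of (Sum.inl t) * FreeSemigroup.of (Sum.inl t'))
      (FreeSemigroup.of (Sum.inl (t * t')))
  | right (y y' : U) : FreeProductRel
      (FreeSemigroup.of (Sum.inr y) * FreeSemigroup.of (Sum.inr y'))
      (FreeSemigroup.of (Sum.inr (y * y')))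

/-- The free product `T * U` of semigroups (units of `T` and `U`, if any, are not identified). -/
abbrev FreeProduct : Type (max u w) := (conGen (FreeProductRel T U)).Quotient

/-- The embedding `T → T * U`. -/
def FreeProduct.inl : T →ₙ* FreeProduct T U where
  toFun t := ((FreeSemigroup.of (Sum.inl t) : FreeSemigroup (T ⊕ U)) : FreeProduct T U)
  map_mul' t t' := by
    rw [← Con.coe_mul]
    exact ((Con.eq _).2 (ConGen.Rel.of _ _ (FreeProductRel.left t t'))).symm

/-- The embedding `U → T * U`. -/
def FreeProduct.inr : U →ₙ* FreeProduct T U where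
  toFun y := ((FreeSemigroup.of (Sum.inr y) : FreeSemigroup (T ⊕ U)) : FreeProduct T U)
  map_mul' y y' := by
    rw [← Con.coe_mul]
    exact ((Con.eq _).2 (ConGen.Rel.of _ _ (FreeProductRel.right y y'))).symm

end FreeProduct

end PartialCoh

/-! Both parts follow from one fact: if normal forms over `W` have a well-behaved length
(`IsReducedLength`), the cochains on `S^n` that vanish on `W_n` form an acyclic complex
(`IsReducedLength.exists_relative_primitive`). Restriction to `W_n` is surjective on cochains, so
acyclicity of its kernel gives isomorphisms in cohomology.

The length comes from the van der Waerden trick: letters of `W` act on words by `push`, this action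
respects the relations `xy = z` as soon as `W` is `OverlapClosed`, and acting on the empty word
recovers the normal form. A canonic `J`-root is `OverlapClosed`, and so is the union of the factors
in a free product.

Acyclicity is a discrete Morse argument. Tuples outside `W_n` are paired: an upper cell has two
neighbouring entries whose product has additive length, and its lower partner multiplies them. Both
have the same total length, and every other face of the upper cell is shorter or again upper
(`IsCollapsibleAt.face`). By induction on total length, a relative cocycle is determined by its
values on upper cells, and these values can be matched by a coboundary.

For `T * U` with `W = T ∪ U`, in degrees `n ≥ 1` the set `W_n` is the disjoint union of `T^n` and
`U^n`. Since `H^n` also involves degree `n - 1`, this gives the direct sum for `n ≥ 2`. -/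

namespace PartialCoh

/-! ### Normal forms over `W` and their length. -/

section NormalForms

variable {S : Type u} [Semigroup S] {W : Set S}

/-- If two overlapping products of elements of `W` lie in `W`, so does the triple product. -/
def OverlapClosed (W : Set S) : Prop :=
  ∀ x ∈ W, ∀ y ∈ W, ∀ z ∈ W, x * y ∈ W → y * z ∈ W → x * y * z ∈ W

theorem isReducedDecomposition_pair {x y : S} (hx : x ∈ W) (hy : y ∈ W) (hxy : x * y ∉ W) :
    IsReducedDecomposition W (x * y) (k := 1) ![x, y] := by
  refine ⟨fun i => ?_, rfl, fun i m h hm => ?_⟩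
  · fin_cases i
    · exact hx
    · exact hy
  · obtain rfl : i = 0 := by omega
    obtain rfl : m = 1 := by omega
    exact hxy

/-- Were `xyz` outside `W`, both `(xy, z)` and `(x, yz)` would be reduced decompositions of it.
Uniqueness forces `xy = x` and `yz = z`, and the `J`-condition then puts `xz = xyz` in `W`. -/
theorem overlapClosed_of_isCanonic_of_isJ (hC : IsCanonic W) (hJ : IsJ W) : OverlapClosed W := by
  intro x hx y hy z hz hxy hyz
  by_contra h
  have h₁ := isReducedDecomposition_pair hxy hz h
  have h₂ := isReducedDecomposition_pair hx hyz (by rwa [← mul_assoc])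
  rw [← mul_assoc] at h₂
  have key := (hC (x * y * z)).unique (y₁ := ⟨1, ![x * y, z]⟩) (y₂ := ⟨1, ![x, y * z]⟩) h₁ h₂
  have key' : ![x * y, z] = ![x, y * z] := eq_of_heq (Sigma.mk.inj key).2
  have e₁ : x * y = x := congrFun key' 0
  have e₂ : z = y * z := congrFun key' 1
  apply h
  rw [e₁]
  exact hJ x hx y hy z hz e₁ e₂.symm

open Classical in
/-- Left multiplication by a letter on words in the alphabet `W`: the new letter absorbs the
following ones as long as the product stays in `W`. -/
noncomputable def push : List W → W → List W
  | [], x => [x]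
  | y :: l, x => if h : (x : S) * y ∈ W then push l ⟨x * y, h⟩ else x :: y :: l

theorem push_cons_of_mem {x y : W} (h : (x : S) * y ∈ W) (l : List W) :
    push (y :: l) x = push l ⟨x * y, h⟩ := by
  rw [push, dif_pos h]

theorem push_cons_of_notMem {x y : W} (h : (x : S) * y ∉ W) (l : List W) :
    push (y :: l) x = x :: y :: l := by
  rw [push, dif_neg h]

/-- This is what makes `push` an action of `S`. If `y` absorbs the next letter `z`, overlap closure
ensures that `xy` absorbs it too; if not, `y` stays at the head and merges with `x`, giving `xy` in
front of `z`. -/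
theorem push_push (hP : OverlapClosed W) {x y : W} (h : (x : S) * y ∈ W) (l : List W) :
    push (push l y) x = push l ⟨x * y, h⟩ := by
  induction l generalizing x y with
  | nil => exact push_cons_of_mem h []
  | cons z l ih =>
    by_cases hyz : (y : S) * z ∈ W
    · have hxyz := hP x x.2 y y.2 z z.2 h hyz
      have hxyz' : (x : S) * (⟨(y : S) * z, hyz⟩ : W) ∈ W := by simpa only [mul_assoc] using hxyz
      rw [push_cons_of_mem hyz, ih hxyz', push_cons_of_mem (x := ⟨(x : S) * y, h⟩) hxyz]
      simp only [mul_assoc]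
    · rw [push_cons_of_notMem hyz, push_cons_of_mem h]

theorem length_push_le (l : List W) (x : W) :
    (push l x).length ≤ l.length + 1 ∧ ((push l x).length = l.length + 1 → push l x = x :: l) := by
  induction l generalizing x with
  | nil => simp [push]
  | cons y l ih =>
    by_cases h : (x : S) * y ∈ W
    · rw [push_cons_of_mem h]
      have := (ih ⟨x * y, h⟩).1
      simp only [List.length_cons]
      exact ⟨by omega, fun h' => by omega⟩
    · rw [push_cons_of_notMem h]
      simp

theorem length_foldr_push_le (l m : List W) :
    (l.foldr (fun x k => push k x) m).length ≤ l.length + m.length ∧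
      ((l.foldr (fun x k => push k x) m).length = l.length + m.length →
        l.foldr (fun x k => push k x) m = l ++ m) := by
  induction l with
  | nil => simp
  | cons x l ih =>
    have h := length_push_le (l.foldr (fun x k => push k x) m) x
    simp only [List.foldr_cons, List.length_cons, List.cons_append]
    refine ⟨by omega, fun h' => ?_⟩
    rw [h.2 (by omega), ih.2 (by omega)]

/-- `ReducedWord W s l`: the word `l` in the alphabet `W` has value `s`, and no product of two
adjacent letters lies in `W`. -/
inductive ReducedWord (W : Set S) : S → List W → Prop
  | single (x : W) : ReducedWord W x [x]
  | cons (x : W) {t : S} {y : W} {l : List W} (h : ReducedWord W t (y :: l))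
      (hxy : (x * y : S) ∉ W) :
      ReducedWord W (x * t) (x :: y :: l)

theorem ReducedWord.push {t : S} {l : List W} (h : ReducedWord W t l) (x : W) :
    ReducedWord W (x * t) (push l x) := by
  induction h generalizing x with
  | single y =>
    by_cases hxy : (x : S) * y ∈ W
    · rw [push_cons_of_mem hxy]
      exact .single ⟨(x : S) * y, hxy⟩
    · rw [push_cons_of_notMem hxy]
      exact .cons x (.single y) hxy
  | @cons y t z l h hyz ih =>
    by_cases hxy : (x : S) * y ∈ W
    · rw [push_cons_of_mem hxy, ← mul_assoc]
      exact ih ⟨(x : S) * y, hxy⟩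
    · rw [push_cons_of_notMem hxy]
      exact .cons x (.cons y h hyz) hxy

theorem exists_reducedWord (hW : Function.Surjective (evalWord W)) (s : S) :
    ∃ l : List W, ReducedWord W s l := by
  obtain ⟨a, rfl⟩ := hW s
  induction a using FreeSemigroup.recOnMul with
  | ih1 x => exact ⟨[x], .single x⟩
  | ih2 x a _ ih =>
    obtain ⟨l, hl⟩ := ih
    exact ⟨_, by simpa [evalWord] using hl.push x⟩

theorem ReducedWord.foldr_push {s : S} {l : List W} (h : ReducedWord W s l) :
    l.foldr (fun x k => PartialCoh.push k x) [] = l := by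
  induction h with
  | single x => rfl
  | cons x h hxy ih => rw [List.foldr_cons, ih, push_cons_of_notMem hxy]

/-- The left side depends on `s` only; at the empty word the right side is `l` itself. Hence reduced
words are unique. -/
theorem ReducedWord.map_apply {act : S →ₙ* Function.End (List W)}
    (hact : ∀ (x : W) l, act x l = PartialCoh.push l x) {s : S} {l : List W}
    (h : ReducedWord W s l) (m : List W) :
    act s m = l.foldr (fun x k => PartialCoh.push k x) m := by
  induction h with
  | single x => exact hact x m
  | cons x h hxy ih =>
    rw [map_mul, List.foldr_cons, ← ih, ← hact]
    rfl

theorem ReducedWord.eq_map_apply_nil {act : S →ₙ* Function.End (List W)}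
    (hact : ∀ (x : W) l, act x l = PartialCoh.push l x) {s : S} {l : List W}
    (h : ReducedWord W s l) : act s [] = l := by
  rw [h.map_apply hact, h.foldr_push]

theorem ReducedWord.eq_of_word_eq {s s' : S} {l : List W} (h : ReducedWord W s l)
    (h' : ReducedWord W s' l) : s = s' := by
  induction h generalizing s' with
  | single x => cases h'; rfl
  | cons x h hxy ih =>
    cases h' with
    | cons _ h' _ => rw [ih h']

/-- The properties of the length of normal forms that the comparison of cohomologies depends on. -/
structure IsReducedLength (W : Set S) (len : S → ℕ) : Prop where
  pos (s : S) : 1 ≤ len s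
  eq_one_iff (s : S) : len s = 1 ↔ s ∈ W
  mul_le (s t : S) : len (s * t) ≤ len s + len t
  mul_mul {x t s : S} (hx : x ∈ W) (hxt : len (x * t) = 1 + len t)
    (hts : len (t * s) = len t + len s) : len (x * (t * s)) = 1 + len (t * s)
  exists_eq_mul {s : S} (hs : s ∉ W) : ∃ y ∈ W, ∃ t, s = y * t ∧ len s = 1 + len t ∧
    ∀ x ∈ W, len (x * s) ≠ 1 + len s → x * y ∈ W
  mul_left_inj {x x' t t' : S} (hx : x ∈ W) (hx' : x' ∈ W) (h : x * t = x' * t')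
    (hxt : len (x * t) = 1 + len t) (hxt' : len (x' * t') = 1 + len t') : x = x' ∧ t = t'
  overlapClosed : OverlapClosed W

/-- Assuming an action instead of a root lets the free product be treated through its universal
property. -/
theorem isReducedLength_of_action (hW : Function.Surjective (evalWord W)) (hP : OverlapClosed W)
    (act : S →ₙ* Function.End (List W)) (hact : ∀ (x : W) l, act x l = push l x) :
    IsReducedLength W fun s => (act s []).length := by
  have nf (s : S) : ReducedWord W s (act s []) := by
    obtain ⟨l, hl⟩ := exists_reducedWord hW s
    rwa [hl.eq_map_apply_nil hact]
  have nf_mul (s t : S) :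
      act (s * t) [] = (act s []).foldr (fun x k => push k x) (act t []) := by
    rw [map_mul, ← (nf s).map_apply hact]
    rfl
  have nf_of_mem {x : S} (hx : x ∈ W) : act x [] = [⟨x, hx⟩] := hact ⟨x, hx⟩ []
  have mul_append {s t : S} (h : (act (s * t) []).length = (act s []).length + (act t []).length) :
      act (s * t) [] = act s [] ++ act t [] := by
    rw [nf_mul] at h ⊢
    exact (length_foldr_push_le _ _).2 h
  have mul_cons {x t : S} (hx : x ∈ W)
      (h : (act (x * t) []).length = 1 + (act t []).length) :
      act (x * t) [] = ⟨x, hx⟩ :: act t [] := by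
    rw [mul_append (by rwa [nf_of_mem hx]), nf_of_mem hx]
    rfl
  constructor
  · intro s
    cases h : act s [] with
    | nil => have := h ▸ nf s; cases this
    | cons x l => simp
  · intro s
    refine ⟨fun h => ?_, fun h => by rw [nf_of_mem h]; rfl⟩
    obtain ⟨x, hx⟩ := List.length_eq_one_iff.1 h
    have := hx ▸ nf s
    cases this
    exact x.2
  · intro s t
    rw [nf_mul]
    exact (length_foldr_push_le _ _).1
  · intro x t s hx hxt hts
    have h₁ := mul_cons hx hxt
    have h₂ := mul_append hts
    have n₁ := nf (x * t)
    have n₂ := nf (t * s)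
    cases e : act t [] with
    | nil => have := e ▸ nf t; cases this
    | cons y l =>
      rw [e] at h₁ h₂
      rw [h₁] at n₁
      rw [h₂] at n₂
      -- Here `y` is the first letter of both `t` and `ts`; the normal form of `xt` shows that `x`
      -- does not merge with it.
      have hxy : x * y ∉ W := by
        generalize x * t = q at n₁
        cases n₁ with
        | cons _ _ h => exact h
      have n₃ := ReducedWord.cons ⟨x, hx⟩ n₂ hxy
      change ReducedWord W (x * (t * s)) _ at n₃
      change (act (x * (t * s)) []).length = 1 + (act (t * s) []).length
      rw [n₃.eq_map_apply_nil hact, h₂]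
      simp [add_comm]
  · intro s hs
    have n := nf s
    generalize hl : act s [] = l at n
    cases n with
    | single x => exact absurd x.2 hs
    | @cons y t z l h hyz =>
      -- The witness is the first letter of the normal form. A letter `x` with `xy ∉ W` could simply
      -- be prepended, which would make the length additive.
      refine ⟨y, y.2, t, rfl, ?_, fun x hx hxs => ?_⟩
      · rw [h.eq_map_apply_nil hact, List.length_cons, add_comm]
      · by_contra hxy
        have n₃ := ReducedWord.cons ⟨x, hx⟩ (.cons y h hyz) hxy
        change ReducedWord W (x * (y * t)) _ at n₃
        apply hxs
        rw [n₃.eq_map_apply_nil hact, List.length_cons, add_comm]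
  · intro x x' t t' hx hx' h hxt hxt'
    have h₁ := mul_cons hx hxt
    rw [h, mul_cons hx' hxt'] at h₁
    have h₂ := List.cons.inj h₁
    exact ⟨(congrArg Subtype.val h₂.1).symm, (nf t).eq_of_word_eq (h₂.2 ▸ nf t')⟩
  · exact hP

theorem exists_isReducedLength_of_isRoot (hW : IsRoot W) (hP : OverlapClosed W) :
    ∃ len : S → ℕ, IsReducedLength W len := by
  let φ : FreeSemigroup W →ₙ* Function.End (List W) := FreeSemigroup.lift fun x l => push l x
  have hφ : Con.ker (evalWord W) ≤ Con.ker φ := by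
    rw [hW.2, Con.conGen_le]
    rintro _ _ ⟨x, y, z, h, rfl, rfl⟩
    rw [Con.ker_rel, map_mul]
    funext l
    have hxy : (x : S) * y ∈ W := h ▸ z.2
    obtain rfl : z = ⟨(x : S) * y, hxy⟩ := Subtype.ext h.symm
    exact push_push hP hxy l
  have hφ' {a b : FreeSemigroup W} (h : evalWord W a = evalWord W b) : φ a = φ b := hφ h
  have hinv := Function.surjInv_eq hW.1
  let act : S →ₙ* Function.End (List W) :=
    { toFun := fun s => φ (Function.surjInv hW.1 s)
      map_mul' := fun s t => by
        rw [← map_mul]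
        apply hφ'
        rw [map_mul, hinv, hinv, hinv] }
  refine ⟨_, isReducedLength_of_action hW.1 hP act fun x l => ?_⟩
  exact congrFun (hφ' (b := FreeSemigroup.of x) (hinv _)) l

end NormalForms

/-! ### The identity `∂∂ = 0`. -/

section CoboundarySquare

variable {S : Type u} [Semigroup S] {A : Type v} [AddCommGroup A]

/-- Maps `S → A` as a module over `S`, acting by `(y φ)(x) = φ (x y)`. -/
def translation (S : Type u) [Semigroup S] (A : Type v) [AddCommGroup A] :
    S →ₙ* AddMonoid.End (S → A) where
  toFun y :=
    { toFun := fun φ x => φ (x * y)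
      map_zero' := rfl
      map_add' := fun _ _ => rfl }
  map_mul' y z := by
    ext φ x
    exact congrArg φ (mul_assoc x y z).symm

@[simp]
theorem translation_apply (y : S) (φ : S → A) (x : S) : translation S A y φ x = φ (x * y) := rfl

theorem contractNth_cons_zero {n : ℕ} (x : S) (y : Fin (n + 1) → S) :
    Fin.contractNth (0 : Fin (n + 1)).castSucc (· * ·) (Fin.cons x y : Fin (n + 2) → S) =
      Fin.cons (x * y 0) (Fin.tail y) := by
  funext k
  refine Fin.cases ?_ (fun k => ?_) k
  · exact Fin.contractNth_apply_of_eq _ _ _ _ rfl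
  · exact Fin.contractNth_apply_of_gt _ _ _ _ (by simp)

theorem contractNth_cons_succ {n : ℕ} (x : S) (y : Fin (n + 1) → S) (j : Fin n) :
    Fin.contractNth j.succ.castSucc (· * ·) (Fin.cons x y : Fin (n + 2) → S) =
      Fin.cons x (Fin.contractNth j.castSucc (· * ·) y) := by
  funext k
  refine Fin.cases ?_ (fun k => ?_) k
  · exact Fin.contractNth_apply_of_lt _ _ _ _ (by simp)
  · simp only [Fin.contractNth, Fin.cons_succ]
    simp

/-- Freezing the first variable turns a cochain into one of lower degree with values in `S → A`, so
that `∂∂ = 0` can be proved by induction on the degree. -/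
theorem coboundary_cons (ρ : S →ₙ* AddMonoid.End A) (n : ℕ) (f : (Fin (n + 1) → S) → A)
    (x : S) (y : Fin (n + 1) → S) :
    coboundary ρ (n + 1) f (Fin.cons x y) =
      ρ x (f y) - coboundary (translation S A) n (fun z a => f (Fin.cons a z)) y x := by
  have init_cons : (Fin.init (Fin.cons x y : Fin (n + 2) → S) : Fin (n + 1) → S) =
      Fin.cons x (Fin.init y) := by
    funext k
    refine Fin.cases rfl (fun k => ?_) k
    rfl
  simp only [coboundary, AddMonoidHom.coe_mk, ZeroHom.coe_mk, Fin.sum_univ_succ,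
    contractNth_cons_zero, contractNth_cons_succ, init_cons, Fin.tail_cons, Fin.cons_zero,
    Pi.add_apply, Finset.sum_apply, Pi.smul_apply]
  change ρ x (f y) + (_ + _) + _ = ρ x (f y) - (f (Fin.cons (x * y 0) (Fin.tail y)) + _ + _)
  simp only [Fin.val_zero, Fin.val_succ, pow_succ, mul_neg, mul_one, neg_smul, neg_neg,
    Finset.sum_neg_distrib, pow_zero, one_smul]
  abel

theorem coboundary_zero_apply (ρ : S →ₙ* AddMonoid.End A) (f : (Fin 0 → S) → A)
    (x : Fin 1 → S) : coboundary ρ 0 f x = ρ (x 0) (f Fin.elim0) - f Fin.elim0 := by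
  have h (y : Fin 0 → S) : f y = f Fin.elim0 := congrArg f (Subsingleton.elim _ _)
  simp only [coboundary, AddMonoidHom.coe_mk, ZeroHom.coe_mk, Fin.sum_univ_zero, add_zero,
    zero_add, pow_one, neg_smul, one_smul, ← sub_eq_add_neg]
  rw [h, h (Fin.init x)]

theorem coboundary_coboundary_zero (ρ : S →ₙ* AddMonoid.End A) (f : (Fin 0 → S) → A) :
    coboundary ρ 1 (coboundary ρ 0 f) = 0 := by
  funext x
  rw [← Fin.cons_self_tail x, coboundary_cons]
  rw [coboundary_zero_apply, coboundary_zero_apply]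
  simp only [coboundary_zero_apply, translation_apply, Pi.sub_apply, Fin.cons_zero, map_mul,
    map_sub]
  change ρ (x 0) (ρ (Fin.tail x 0) (f Fin.elim0)) - ρ (x 0) (f Fin.elim0) -
    (ρ (x 0) (ρ (Fin.tail x 0) (f Fin.elim0)) - f Fin.elim0 -
      (ρ (x 0) (f Fin.elim0) - f Fin.elim0)) = 0
  abel

theorem coboundary_coboundary_succ (ρ : S →ₙ* AddMonoid.End A) (n : ℕ)
    (f : (Fin (n + 1) → S) → A)
    (hf : coboundary (translation S A) (n + 1)
      (coboundary (translation S A) n (fun z a => f (Fin.cons a z))) = 0) :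
    coboundary ρ (n + 2) (coboundary ρ (n + 1) f) = 0 := by
  funext x
  rw [← Fin.cons_self_tail x, coboundary_cons]
  have h : (fun z a => coboundary ρ (n + 1) f (Fin.cons a z)) =
      (fun z a => ρ a (f z)) -
        coboundary (translation S A) n (fun z a => f (Fin.cons a z)) := by
    funext z a
    exact coboundary_cons ρ n f a z
  have h' (y : Fin (n + 2) → S) (a : S) :
      coboundary (translation S A) (n + 1) (fun z a => ρ a (f z)) y a =
        ρ a (coboundary ρ (n + 1) f y) := by
    simp only [coboundary, AddMonoidHom.coe_mk, ZeroHom.coe_mk, Pi.add_apply,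
      Finset.sum_apply, Pi.smul_apply, map_add, map_sum, map_zsmul, translation_apply, map_mul]
    rfl
  rw [h, map_sub, hf, sub_zero, h', sub_self]
  rfl

/-- The induction replaces the coefficients `B` by `S → B`, and this universe is stable under that
operation. -/
theorem coboundary_coboundary_of_max {B : Type max u v} [AddCommGroup B]
    (ρ : S →ₙ* AddMonoid.End B) (n : ℕ) (f : (Fin n → S) → B) :
    coboundary ρ (n + 1) (coboundary ρ n f) = 0 := by
  induction n generalizing B with
  | zero => exact coboundary_coboundary_zero ρ f
  | succ n ih => exact coboundary_coboundary_succ ρ n f (ih _ _)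

theorem coboundary_coboundary (ρ : S →ₙ* AddMonoid.End A) (n : ℕ) (f : (Fin n → S) → A) :
    coboundary ρ (n + 1) (coboundary ρ n f) = 0 := by
  cases n with
  | zero => exact coboundary_coboundary_zero ρ f
  | succ n => exact coboundary_coboundary_succ ρ n f (coboundary_coboundary_of_max.{u, v} _ _ _)

end CoboundarySquare

/-! ### The matching on tuples outside `W_n`. -/

section Matching

variable {S : Type u} [Semigroup S] {W : Set S} {len : S → ℕ}

theorem segProd_mem_of_adjacent (hP : OverlapClosed W) {n : ℕ} {x : Fin n → S}
    (hx : ∀ k, x k ∈ W)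
    (hxx : ∀ (k : ℕ) (hk : k + 1 < n), x ⟨k, by omega⟩ * x ⟨k + 1, hk⟩ ∈ W) (i m : ℕ)
    (h : i + m < n) : segProd x i m h ∈ W := by
  -- Two consecutive lengths are carried along, since overlap closure is applied to a segment and
  -- the two entries after it.
  have key : (∀ h, segProd x i m h ∈ W) ∧ ∀ h, segProd x i (m + 1) h ∈ W := by
    induction m with
    | zero => exact ⟨fun h => hx _, fun h => hxx i h⟩
    | succ m ih =>
      obtain ⟨h₁, h₂⟩ := ih (by omega)
      exact ⟨h₂, fun h => hP _ (h₁ (by omega)) _ (hx ⟨i + m + 1, by omega⟩) _ (hx ⟨i + m + 2, h⟩)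
        (h₂ (by omega)) (hxx _ h)⟩
  exact key.1 h

theorem contractNth_mk_of_lt {n : ℕ} (x : Fin (n + 1) → S) (j : Fin n) {k : ℕ} (hk : k < n)
    (h : k < j) : Fin.contractNth j.castSucc (· * ·) x ⟨k, hk⟩ = x ⟨k, by omega⟩ :=
  Fin.contractNth_apply_of_lt _ _ _ _ h

theorem contractNth_mk_self {n : ℕ} (x : Fin (n + 1) → S) {j : ℕ} (hj : j < n) :
    Fin.contractNth (⟨j, hj⟩ : Fin n).castSucc (· * ·) x ⟨j, hj⟩ =
      x ⟨j, by omega⟩ * x ⟨j + 1, by omega⟩ :=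
  Fin.contractNth_apply_of_eq _ _ _ _ rfl

theorem contractNth_mk_of_gt {n : ℕ} (x : Fin (n + 1) → S) (j : Fin n) {k : ℕ} (hk : k < n)
    (h : j < k) : Fin.contractNth j.castSucc (· * ·) x ⟨k, hk⟩ = x ⟨k + 1, by omega⟩ :=
  Fin.contractNth_apply_of_gt _ _ _ _ h

/-- The total length of the entries of a tuple. -/
def tupleLength (len : S → ℕ) {n : ℕ} (x : Fin n → S) : ℕ := ∑ k, len (x k)

theorem tupleLength_contractNth {n : ℕ} (x : Fin (n + 1) → S) (j : Fin n) :
    tupleLength len (Fin.contractNth j.castSucc (· * ·) x) +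
        (len (x j.castSucc) + len (x j.succ)) =
      tupleLength len x + len (x j.castSucc * x j.succ) := by
  have h₁ : (fun k => len (Fin.contractNth j.castSucc (· * ·) x k)) =
      Function.update (fun k => len (x (j.succ.succAbove k))) j
        (len (x j.castSucc * x j.succ)) := by
    funext k
    rcases lt_trichotomy k j with h | rfl | h
    · rw [Function.update_of_ne h.ne, Fin.contractNth_apply_of_lt _ _ _ _ (by simpa using h),
        Fin.succAbove_of_castSucc_lt _ _ (Nat.lt_succ_of_lt h)]
    · rw [Function.update_self, Fin.contractNth_apply_of_eq _ _ _ _ rfl]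
    · rw [Function.update_of_ne h.ne', Fin.contractNth_apply_of_gt _ _ _ _ (by simpa using h),
        Fin.succAbove_of_le_castSucc _ _ (Nat.succ_le_of_lt h)]
  have h₂ := Finset.sum_update_of_mem (Finset.mem_univ j)
    (fun k => len (x (j.succ.succAbove k))) (len (x j.castSucc * x j.succ))
  have h₃ := Finset.add_sum_erase _ (fun k => len (x (j.succ.succAbove k))) (Finset.mem_univ j)
  rw [Fin.succAbove_of_castSucc_lt _ _ (Fin.castSucc_lt_succ (i := j))] at h₃
  rw [Finset.sdiff_singleton_eq_erase] at h₂
  unfold tupleLength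
  rw [Fin.sum_univ_succAbove _ j.succ, h₁, h₂]
  omega

theorem IsReducedLength.tupleLength_tail_lt (hL : IsReducedLength W len) {n : ℕ}
    (x : Fin (n + 1) → S) : tupleLength len (Fin.tail x) < tupleLength len x := by
  have := hL.pos (x 0)
  simp only [tupleLength, Fin.sum_univ_succ, Fin.tail]
  omega

theorem IsReducedLength.tupleLength_init_lt (hL : IsReducedLength W len) {n : ℕ}
    (x : Fin (n + 1) → S) :
    tupleLength len (Fin.init x : Fin n → S) < tupleLength len x := by
  have := hL.pos (x (Fin.last n))
  simp only [tupleLength, Fin.sum_univ_castSucc, Fin.init]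
  omega

/-- The first `i + 1` entries of `x` have adjacent products in `W`, and the length of the product
of the entries number `i` and `i + 1` is the sum of their lengths. These tuples are the upper
cells of the matching; the lower partner is obtained by multiplying these two entries. -/
def IsCollapsibleAt (W : Set S) (len : S → ℕ) {n : ℕ} (x : Fin n → S) (i : ℕ) : Prop :=
  ∃ h : i + 1 < n, (∀ (k : ℕ) (hk : k ≤ i), x ⟨k, by omega⟩ ∈ W) ∧
    (∀ (k : ℕ) (hk : k < i), x ⟨k, by omega⟩ * x ⟨k + 1, by omega⟩ ∈ W) ∧
    len (x ⟨i, by omega⟩ * x ⟨i + 1, h⟩) = 1 + len (x ⟨i + 1, h⟩)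

theorem IsCollapsibleAt.tupleLength_contractNth (hL : IsReducedLength W len) {n : ℕ}
    {c : Fin (n + 1) → S} {j : Fin n} (hc : IsCollapsibleAt W len c j) :
    tupleLength len (Fin.contractNth j.castSucc (· * ·) c) = tupleLength len c := by
  obtain ⟨_, h, _, h'⟩ := hc
  have h₁ := PartialCoh.tupleLength_contractNth (len := len) c j
  have h₂ : len (c j.castSucc) = 1 := (hL.eq_one_iff _).2 (h j le_rfl)
  have h₃ : len (c j.castSucc * c j.succ) = 1 + len (c j.succ) := h'
  omega

/-- Left of `j` two letters merge into one, so the total length drops. Right of `j` it drops unless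
the product has additive length; then the collapsible pair survives, by `mul_mul` when its second
entry is the one multiplied. -/
theorem IsCollapsibleAt.face (hL : IsReducedLength W len) {n : ℕ}
    {c : Fin (n + 1) → S} {j : ℕ} (hc : IsCollapsibleAt W len c j) {k : Fin n} (hk : (k : ℕ) ≠ j) :
    tupleLength len (Fin.contractNth k.castSucc (· * ·) c) < tupleLength len c ∨
      IsCollapsibleAt W len (Fin.contractNth k.castSucc (· * ·) c) j := by
  obtain ⟨hj, hW, hWW, hlen⟩ := hc
  have hkc := PartialCoh.tupleLength_contractNth (len := len) c k
  obtain ⟨k, hkn⟩ := k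
  simp only [Fin.castSucc_mk, Fin.succ_mk] at hkc hk ⊢
  rcases lt_or_gt_of_ne hk with hkj | hkj
  · left
    have h₁ := (hL.eq_one_iff _).2 (hWW k hkj)
    have h₂ := hL.pos (c ⟨k, by omega⟩)
    have h₃ := hL.pos (c ⟨k + 1, by omega⟩)
    omega
  · by_cases hadd : len (c ⟨k, by omega⟩ * c ⟨k + 1, by omega⟩) =
        len (c ⟨k, by omega⟩) + len (c ⟨k + 1, by omega⟩)
    · right
      have e (i : ℕ) (hi : i < k) := contractNth_mk_of_lt c ⟨k, hkn⟩ (k := i) (by omega) hi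
      refine ⟨by omega, fun i hi => ?_, fun i hi => ?_, ?_⟩
      · erw [e i (by omega)]
        exact hW i hi
      · erw [e i (by omega), e (i + 1) (by omega)]
        exact hWW i hi
      · erw [e j (by omega)]
        rcases Nat.lt_or_ge (j + 1) k with h | h
        · erw [e (j + 1) h]
          exact hlen
        · obtain rfl : k = j + 1 := by omega
          erw [contractNth_mk_self c hkn]
          exact hL.mul_mul (hW j le_rfl) hlen hadd
    · left
      have := hL.mul_le (c ⟨k, by omega⟩) (c ⟨k + 1, by omega⟩)
      omega

theorem IsCollapsibleAt.contractNth_notMem (hL : IsReducedLength W len) {n : ℕ}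
    {c : Fin (n + 1) → S} {j : Fin n} (hc : IsCollapsibleAt W len c j) :
    Fin.contractNth j.castSucc (· * ·) c j ∉ W := by
  obtain ⟨j, hj⟩ := j
  obtain ⟨_, _, _, hlen⟩ := hc
  rw [contractNth_mk_self, ← hL.eq_one_iff]
  dsimp only at hlen
  have := hL.pos (c ⟨j + 1, by omega⟩)
  omega

theorem IsCollapsibleAt.contractNth_mem_of_lt {n : ℕ} {c : Fin (n + 1) → S} {j : Fin n}
    (hc : IsCollapsibleAt W len c j) {i : ℕ} (hi : i < j) :
    Fin.contractNth j.castSucc (· * ·) c ⟨i, by omega⟩ ∈ W := by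
  rw [contractNth_mk_of_lt c j _ hi]
  exact hc.2.1 i hi.le

theorem IsCollapsibleAt.contractNth_notMem_tuples (hL : IsReducedLength W len) {n : ℕ}
    {c : Fin (n + 1) → S} {j : Fin n} (hc : IsCollapsibleAt W len c j) :
    Fin.contractNth j.castSucc (· * ·) c ∉ tuples W n :=
  fun h => hc.contractNth_notMem hL (h j 0 j.2)

/-- A collapsible position must lie before `j`, the first entry outside `W`. But there `c i * c (i +
1)` is in `W`, so the product at position `i` is too short to have additive length. -/
theorem IsCollapsibleAt.not_isCollapsibleAt_contractNth (hL : IsReducedLength W len) {n : ℕ}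
    {c : Fin (n + 1) → S} {j : Fin n} (hc : IsCollapsibleAt W len c j) (i : ℕ) :
    ¬ IsCollapsibleAt W len (Fin.contractNth j.castSucc (· * ·) c) i := by
  rintro ⟨hi, hW, _, hlen⟩
  have hij : i < j := by
    by_contra h
    exact hc.contractNth_notMem hL (hW j (by omega))
  obtain ⟨j, hj⟩ := j
  simp only at hij
  obtain ⟨_, hW', hWW, hlen'⟩ := hc
  dsimp only at hlen'
  have hmem := (hL.eq_one_iff _).2 (hWW i hij)
  rw [contractNth_mk_of_lt c ⟨j, hj⟩ _ hij] at hlen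
  rcases Nat.lt_or_ge (i + 1) j with h | h
  · rw [contractNth_mk_of_lt c ⟨j, hj⟩ _ h] at hlen
    have := hL.pos (c ⟨i + 1, by omega⟩)
    omega
  · obtain rfl : j = i + 1 := by omega
    rw [contractNth_mk_self, hlen', ← mul_assoc] at hlen
    have := hL.mul_le (c ⟨i, by omega⟩ * c ⟨i + 1, by omega⟩) (c ⟨i + 1 + 1, by omega⟩)
    omega

/-- The index is recovered as the first entry outside `W`, and the two factors by splitting off its
first letter. -/
theorem IsCollapsibleAt.eq_of_contractNth_eq (hL : IsReducedLength W len) {n : ℕ}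
    {c c' : Fin (n + 1) → S} {j j' : Fin n} (hc : IsCollapsibleAt W len c j)
    (hc' : IsCollapsibleAt W len c' j')
    (h : Fin.contractNth j.castSucc (· * ·) c = Fin.contractNth j'.castSucc (· * ·) c') :
    c = c' ∧ j = j' := by
  obtain rfl : j = j' := by
    rcases lt_trichotomy j j' with hj | hj | hj
    · exact absurd (h ▸ hc'.contractNth_mem_of_lt hj) (hc.contractNth_notMem hL)
    · exact hj
    · exact absurd (h.symm ▸ hc.contractNth_mem_of_lt hj) (hc'.contractNth_notMem hL)
  refine ⟨?_, rfl⟩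
  obtain ⟨j, hj⟩ := j
  obtain ⟨_, hW, _, hlen⟩ := hc
  obtain ⟨_, hW', _, hlen'⟩ := hc'
  have hmul := congrFun h ⟨j, hj⟩
  rw [contractNth_mk_self, contractNth_mk_self] at hmul
  have hinj := hL.mul_left_inj (hW j le_rfl) (hW' j le_rfl) hmul hlen hlen'
  funext ⟨k, hk⟩
  rcases lt_trichotomy k j with hkj | rfl | hkj
  · have := congrFun h ⟨k, by omega⟩
    rwa [contractNth_mk_of_lt _ _ _ hkj, contractNth_mk_of_lt _ _ _ hkj] at this
  · exact hinj.1
  · obtain ⟨k, rfl⟩ := Nat.exists_eq_succ_of_ne_zero (Nat.ne_zero_of_lt hkj)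
    rcases (Nat.le_of_lt_succ hkj).eq_or_lt with rfl | hkj
    · exact hinj.2
    · have := congrFun h ⟨k, by omega⟩
      rwa [contractNth_mk_of_gt _ _ _ hkj, contractNth_mk_of_gt _ _ _ hkj] at this

theorem exists_contractNth_eq {n : ℕ} (x : Fin n → S) {i : ℕ} (hi : i < n) {y t : S}
    (hx : x ⟨i, hi⟩ = y * t) :
    ∃ c : Fin (n + 1) → S, Fin.contractNth (⟨i, hi⟩ : Fin n).castSucc (· * ·) c = x ∧
      (∀ (k : ℕ) (hk : k < i), c ⟨k, by omega⟩ = x ⟨k, by omega⟩) ∧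
      c ⟨i, by omega⟩ = y ∧ c ⟨i + 1, by omega⟩ = t := by
  refine ⟨fun k => if h : (k : ℕ) < i then x ⟨k, by omega⟩ else if (k : ℕ) = i then y else
    if h : (k : ℕ) = i + 1 then t else x ⟨k - 1, by omega⟩, ?_, fun k hk => dif_pos hk,
    by simp, by simp⟩
  funext ⟨k, hk⟩
  rcases lt_trichotomy k i with h | rfl | h
  · rw [contractNth_mk_of_lt _ _ _ h, dif_pos h]
  · rw [contractNth_mk_self, hx]
    simp
  · rw [contractNth_mk_of_gt _ _ _ h, dif_neg (by simp only; omega), if_neg (by simp only; omega),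
      dif_neg (by simp only; omega)]
    rfl

/-- A tuple is in `W_n`, or an upper cell of the matching, or a lower cell. -/
theorem IsReducedLength.trichotomy (hL : IsReducedLength W len) {n : ℕ} (x : Fin n → S) :
    x ∈ tuples W n ∨ (∃ i, IsCollapsibleAt W len x i) ∨
      ∃ (c : Fin (n + 1) → S) (j : Fin n), IsCollapsibleAt W len c j ∧
        Fin.contractNth j.castSucc (· * ·) c = x := by
  by_contra! ⟨hx, hcol, hred⟩
  -- The tuple is scanned from the left, keeping the entries and the adjacent products in `W`; any
  -- obstruction would exhibit an upper or a lower cell.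
  have key (i : ℕ) (hi : i ≤ n) : (∀ (k : ℕ) (hk : k < i), x ⟨k, by omega⟩ ∈ W) ∧
      ∀ (k : ℕ) (hk : k + 1 < i), x ⟨k, by omega⟩ * x ⟨k + 1, by omega⟩ ∈ W := by
    induction i with
    | zero => exact ⟨fun k hk => by omega, fun k hk => by omega⟩
    | succ i ih =>
      obtain ⟨hW, hWW⟩ := ih (by omega)
      have hprev (k : ℕ) (hk : k + 1 = i) :
          len (x ⟨k, by omega⟩ * x ⟨k + 1, by omega⟩) ≠ 1 + len (x ⟨k + 1, by omega⟩) :=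
        fun h => hcol k ⟨by omega, fun l hl => hW l (by omega), fun l hl => hWW l (by omega), h⟩
      have hi' : x ⟨i, hi⟩ ∈ W := by
        by_contra hxi
        -- Splitting the first letter `y` off the first entry outside `W` gives an upper partner.
        -- The product of the previous entry with `y` is in `W` because the previous pair is not
        -- collapsible.
        obtain ⟨y, hy, t, hyt, hlen, hback⟩ := hL.exists_eq_mul hxi
        obtain ⟨c, hc, hlt, hcy, hct⟩ := exists_contractNth_eq x hi hyt
        refine hred c ⟨i, hi⟩ ⟨by simp only; omega, fun k hk => ?_, fun k hk => ?_, ?_⟩ hc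
        · rcases Nat.lt_or_eq_of_le hk with hk | rfl
          · rw [hlt k hk]
            exact hW k hk
          · exact hcy ▸ hy
        · simp only at hk
          rw [hlt k hk]
          rcases Nat.lt_or_eq_of_le (Nat.succ_le_of_lt hk) with hk | hk
          · rw [hlt (k + 1) hk]
            exact hWW k hk
          · subst hk
            rw [hcy]
            exact hback _ (hW k (by omega)) (hprev k rfl)
        · simp only
          rw [hcy, hct, ← hyt, hlen]
      refine ⟨fun k hk => ?_, fun k hk => ?_⟩
      · rcases Nat.lt_or_eq_of_le (Nat.le_of_lt_succ hk) with hk | rfl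
        · exact hW k hk
        · exact hi'
      · rcases Nat.lt_or_eq_of_le (Nat.le_of_lt_succ hk) with hk | rfl
        · exact hWW k hk
        -- The product of two letters has length at most 2; it is not 2, as the pair is not
        -- collapsible, so it is 1.
        · have h₁ := hprev k rfl
          have h₂ := hL.mul_le (x ⟨k, by omega⟩) (x ⟨k + 1, by omega⟩)
          have h₃ := (hL.eq_one_iff _).2 (hW k (by omega))
          have h₄ := (hL.eq_one_iff _).2 hi'
          have h₅ := hL.pos (x ⟨k, by omega⟩ * x ⟨k + 1, by omega⟩)
          exact (hL.eq_one_iff _).1 (by omega)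
  exact hx fun i m h => segProd_mem_of_adjacent hL.overlapClosed
    (fun k => (key n le_rfl).1 k k.2) (key n le_rfl).2 i m h

end Matching

/-! ### Acyclicity of the relative cochain complex. -/

section Acyclic

variable {S : Type u} [Semigroup S] {W : Set S} {len : S → ℕ} {A : Type v} [AddCommGroup A]

theorem coboundary_apply (ρ : S →ₙ* AddMonoid.End A) (n : ℕ) (f : (Fin n → S) → A)
    (x : Fin (n + 1) → S) :
    coboundary ρ n f x = ρ (x 0) (f (Fin.tail x)) +
      ∑ j : Fin n, (-1 : ℤ) ^ ((j : ℕ) + 1) • f (Fin.contractNth j.castSucc (· * ·) x) +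
      (-1 : ℤ) ^ (n + 1) • f (Fin.init x) := rfl

theorem coboundary_apply_of_single_face (ρ : S →ₙ* AddMonoid.End A) {n : ℕ}
    {f : (Fin n → S) → A} {x : Fin (n + 1) → S} {j : Fin n} (htail : f (Fin.tail x) = 0)
    (hinit : f (Fin.init x) = 0)
    (h : ∀ k, k ≠ j → f (Fin.contractNth k.castSucc (· * ·) x) = 0) :
    coboundary ρ n f x =
      (-1 : ℤ) ^ ((j : ℕ) + 1) • f (Fin.contractNth j.castSucc (· * ·) x) := by
  rw [coboundary_apply, htail, hinit, Finset.sum_eq_single j]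
  · simp
  · intro k _ hk
    rw [h k hk, smul_zero]
  · simp

theorem neg_one_pow_smul_smul (k : ℕ) (a : A) : (-1 : ℤ) ^ k • (-1 : ℤ) ^ k • a = a := by
  rw [smul_smul, ← mul_pow]
  simp

/-- A relative cocycle that vanishes on the upper cells of the matching is zero. -/
theorem IsReducedLength.eq_zero_of_cocycle (hL : IsReducedLength W len)
    (ρ : S →ₙ* AddMonoid.End A) {n : ℕ} {f : (Fin n → S) → A} (hf : coboundary ρ n f = 0)
    (hW : ∀ x ∈ tuples W n, f x = 0) (hcol : ∀ x i, IsCollapsibleAt W len x i → f x = 0) :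
    f = 0 := by
  have key (N : ℕ) : ∀ x, tupleLength len x = N → f x = 0 := by
    induction N using Nat.strong_induction_on with
    | _ N ih =>
      intro x hx
      rcases hL.trichotomy x with h | ⟨i, h⟩ | ⟨c, j, hc, rfl⟩
      · exact hW x h
      · exact hcol x i h
      · have hN := hc.tupleLength_contractNth hL
        -- The cocycle identity at the upper partner `c` reduces to the single face `x`, with
        -- coefficient a sign.
        have h := coboundary_apply_of_single_face ρ (f := f) (x := c) (j := j)
          (ih _ (by have := hL.tupleLength_tail_lt c; omega) _ rfl)
          (ih _ (by have := hL.tupleLength_init_lt c; omega) _ rfl) fun k hk => by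
            rcases hc.face hL (k := k) (by simpa [Fin.ext_iff] using hk) with h | h
            · exact ih _ (by omega) _ rfl
            · exact hcol _ _ h
        rw [hf, Pi.zero_apply] at h
        rw [← neg_one_pow_smul_smul (j + 1) (f _), ← h, smul_zero]
  exact funext fun x => key _ x rfl

/-- Well-founded recursion in which the earlier values are extended by zero to a total function, so
that `coboundary` can be applied to them. -/
theorem exists_eq_of_measure {α : Type*} {β : Type*} [Zero β] (μ : α → ℕ)
    (F : α → (α → β) → β) :
    ∃ g : α → β, ∀ x, g x = F x fun y => if μ y < μ x then g y else 0 := by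
  refine ⟨(measure μ).wf.fix fun x ih => F x fun y => if h : μ y < μ x then ih y h else 0,
    fun x => ?_⟩
  rw [WellFounded.fix_eq]
  rfl

/-- There is a relative cochain whose coboundary has prescribed values on the upper cells of the
matching. -/
theorem IsReducedLength.exists_coboundary_eq_on (hL : IsReducedLength W len)
    (ρ : S →ₙ* AddMonoid.End A) {n : ℕ} (f : (Fin (n + 1) → S) → A) :
    ∃ g : (Fin n → S) → A, (∀ x ∈ tuples W n, g x = 0) ∧
      ∀ c i, IsCollapsibleAt W len c i → coboundary ρ n g c = f c := by
  classical
  let R (x : Fin n → S) (p : (Fin (n + 1) → S) × Fin n) : Prop :=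
    IsCollapsibleAt W len p.1 p.2 ∧ Fin.contractNth p.2.castSucc (· * ·) p.1 = x
  obtain ⟨g, hg⟩ := exists_eq_of_measure (tupleLength len)
    fun (x : Fin n → S) (u : (Fin n → S) → A) =>
      -- On a lower cell the value solves `∂g = f` at its upper partner for the one unknown face;
      -- elsewhere `g` is zero.
      if h : ∃ p, R x p then
        (-1 : ℤ) ^ ((h.choose.2 : ℕ) + 1) • (f h.choose.1 - coboundary ρ n u h.choose.1)
      else 0
  have hg0 {x : Fin n → S} (h : ¬ ∃ p, R x p) : g x = 0 := by rw [hg, dif_neg h]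
  have hgcol {x : Fin n → S} {i : ℕ} (hx : IsCollapsibleAt W len x i) : g x = 0 := by
    apply hg0
    rintro ⟨p, hp, rfl⟩
    exact hp.not_isCollapsibleAt_contractNth hL i hx
  refine ⟨g, fun x hx => hg0 ?_, fun c j hc => ?_⟩
  · rintro ⟨p, hp, rfl⟩
    exact hp.contractNth_notMem_tuples hL hx
  · obtain ⟨j, rfl⟩ : ∃ j' : Fin n, (j' : ℕ) = j := ⟨⟨j, by have := hc.1; omega⟩, rfl⟩
    have hr : ∃ p, R (Fin.contractNth j.castSucc (· * ·) c) p := ⟨(c, j), hc, rfl⟩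
    have hchoose : hr.choose = (c, j) := by
      obtain ⟨h₁, h₂⟩ := hr.choose_spec
      obtain ⟨h₃, h₄⟩ := h₁.eq_of_contractNth_eq hL hc h₂
      exact Prod.ext h₃ h₄
    have hgr := hg (Fin.contractNth j.castSucc (· * ·) c)
    rw [dif_pos hr, hchoose, hc.tupleLength_contractNth hL] at hgr
    -- The difference `g - u` vanishes on shorter tuples and on upper cells, so the only face of `c`
    -- on which it may be nonzero is the lower partner.
    set u : (Fin n → S) → A := fun y => if tupleLength len y < tupleLength len c then g y else 0
      with hu
    have hlt {y : Fin n → S} (hy : tupleLength len y < tupleLength len c) : (g - u) y = 0 := by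
      simp [hu, hy]
    have h := coboundary_apply_of_single_face ρ (f := g - u) (x := c) (j := j)
      (hlt (hL.tupleLength_tail_lt c)) (hlt (hL.tupleLength_init_lt c)) fun k hk => by
        rcases hc.face hL (k := k) (by simpa [Fin.ext_iff] using hk) with h | h
        · exact hlt h
        · simp [hu, hgcol h]
    have hur : u (Fin.contractNth j.castSucc (· * ·) c) = 0 := by
      simp [hu, hc.tupleLength_contractNth hL]
    rw [Pi.sub_apply, hur, sub_zero, hgr, neg_one_pow_smul_smul, map_sub, Pi.sub_apply] at h
    exact sub_left_inj.1 h

/-- Cochains of `S` that vanish on `W_n` form an acyclic complex. -/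
theorem IsReducedLength.exists_relative_primitive (hL : IsReducedLength W len)
    (ρ : S →ₙ* AddMonoid.End A) {n : ℕ} {f : (Fin (n + 1) → S) → A}
    (hf : coboundary ρ (n + 1) f = 0) (hW : ∀ x ∈ tuples W (n + 1), f x = 0) :
    ∃ g : (Fin n → S) → A, (∀ x ∈ tuples W n, g x = 0) ∧ coboundary ρ n g = f := by
  obtain ⟨g, hg, hgf⟩ := hL.exists_coboundary_eq_on ρ f
  refine ⟨g, hg, (sub_eq_zero.1 (hL.eq_zero_of_cocycle ρ (f := f - coboundary ρ n g) ?_ ?_ ?_)).symm⟩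
  · rw [map_sub, hf, coboundary_coboundary, sub_zero]
  · intro x hx
    have h0 : cochainRestrict W A n g = 0 := funext fun y => hg y.1 y.2
    have h : coboundary ρ n g x = 0 := by
      change cochainRestrict W A (n + 1) (coboundary ρ n g) ⟨x, hx⟩ = 0
      rw [cochainRestrict_coboundary, h0, map_zero]
      rfl
    rw [Pi.sub_apply, hW x hx, h, sub_zero]
  · intro x i hx
    rw [Pi.sub_apply, hgf x i hx, sub_self]

end Acyclic

/-! ### From relative acyclicity to the isomorphism `theta`. -/

section Theta

variable {S : Type u} [Semigroup S] {W : Set S} {len : S → ℕ} {A : Type v} [AddCommGroup A]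

theorem cohomology_mk_eq_zero_iff (ρ : S →ₙ* AddMonoid.End A) {n : ℕ} (f : cocycles ρ n) :
    (QuotientAddGroup.mk f : Cohomology ρ n) = 0 ↔ f.1 ∈ coboundaries ρ n :=
  (QuotientAddGroup.eq_zero_iff f).trans AddSubgroup.mem_addSubgroupOf

theorem partialCohomology_mk_eq_zero_iff (ρ : S →ₙ* AddMonoid.End A) {n : ℕ}
    (f : partialCocycles W ρ n) :
    (QuotientAddGroup.mk f : PartialCohomology W ρ n) = 0 ↔ f.1 ∈ partialCoboundaries W ρ n :=
  (QuotientAddGroup.eq_zero_iff f).trans AddSubgroup.mem_addSubgroupOf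

theorem cochainRestrict_surjective (W : Set S) (A : Type v) [AddCommGroup A] (n : ℕ)
    (f : tuples W n → A) : ∃ g : (Fin n → S) → A, cochainRestrict W A n g = f := by
  classical
  exact ⟨fun x => if h : x ∈ tuples W n then f ⟨x, h⟩ else 0, funext fun x => dif_pos x.2⟩

theorem cochainRestrict_eq_zero_iff {n : ℕ} {f : (Fin n → S) → A} :
    cochainRestrict W A n f = 0 ↔ ∀ x ∈ tuples W n, f x = 0 :=
  ⟨fun h x hx => congrFun h ⟨x, hx⟩, fun h => funext fun x => h x.1 x.2⟩

/-- A cocycle whose restriction to `W_n` is zero is a coboundary. -/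
theorem IsReducedLength.mem_coboundaries (hL : IsReducedLength W len)
    (ρ : S →ₙ* AddMonoid.End A) {n : ℕ} {f : (Fin n → S) → A} (hf : coboundary ρ n f = 0)
    (hW : ∀ x ∈ tuples W n, f x = 0) : f ∈ coboundaries ρ n := by
  cases n with
  -- The empty tuple lies in `W_0`, so in degree 0 the hypothesis already says `f = 0`.
  | zero => exact funext fun x => hW x fun i m h => absurd h (by omega)
  | succ n =>
    obtain ⟨g, -, hg⟩ := hL.exists_relative_primitive ρ hf hW
    exact ⟨g, hg⟩

theorem IsReducedLength.bijective_theta (hL : IsReducedLength W len)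
    (ρ : S →ₙ* AddMonoid.End A) (n : ℕ) : Function.Bijective (theta W ρ n) := by
  constructor
  · rw [injective_iff_map_eq_zero]
    intro a
    induction a using QuotientAddGroup.induction_on with
    | H f =>
      intro h
      rw [cohomology_mk_eq_zero_iff]
      replace h : cochainRestrict W A n f.1 ∈ partialCoboundaries W ρ n :=
        (partialCohomology_mk_eq_zero_iff ρ (cocycleRestrict W ρ n f)).1 h
      have hf : coboundary ρ n f.1 = 0 := f.2
      cases n with
      | zero => exact hL.mem_coboundaries ρ hf (cochainRestrict_eq_zero_iff.1 h)
      | succ n =>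
        obtain ⟨p, hp⟩ := h
        obtain ⟨q, rfl⟩ := cochainRestrict_surjective W A n p
        rw [← cochainRestrict_coboundary] at hp
        have h := hL.mem_coboundaries ρ (f := f.1 - coboundary ρ n q)
          (by rw [map_sub, hf, coboundary_coboundary, sub_zero])
          (cochainRestrict_eq_zero_iff.1 (by rw [map_sub, hp, sub_self]))
        have h' : coboundary ρ n q ∈ coboundaries ρ (n + 1) := ⟨q, rfl⟩
        simpa using add_mem h h'
  · intro b
    induction b using QuotientAddGroup.induction_on with
    | H z =>
      obtain ⟨f, hf⟩ := cochainRestrict_surjective W A n z.1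
      -- An arbitrary extension `f` of `z` has a coboundary vanishing on `W_{n+1}`; subtracting a
      -- relative primitive makes it a cocycle without changing its restriction.
      obtain ⟨g, hg, hgf⟩ := hL.exists_relative_primitive ρ (coboundary_coboundary ρ n f)
        (cochainRestrict_eq_zero_iff.1
          (by rw [cochainRestrict_coboundary, hf]; exact z.2))
      refine ⟨QuotientAddGroup.mk ⟨f - g, ?_⟩, ?_⟩
      · change coboundary ρ n (f - g) = 0
        rw [map_sub, hgf, sub_self]
      · refine congrArg QuotientAddGroup.mk (Subtype.ext ?_)
        change cochainRestrict W A n (f - g) = z.1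
        rw [map_sub, hf, cochainRestrict_eq_zero_iff.2 hg, sub_zero]

end Theta

/-! ### Free products. -/

section FreeProduct

variable {T : Type u} {U : Type w} [Semigroup T] [Semigroup U]

namespace FreeProduct

theorem hom_eq_of_rel {M : Type*} [Semigroup M] (f : T →ₙ* M) (g : U →ₙ* M)
    {a b : FreeSemigroup (T ⊕ U)} (h : conGen (FreeProductRel T U) a b) :
    FreeSemigroup.lift (Sum.elim f g) a = FreeSemigroup.lift (Sum.elim f g) b := by
  have key : conGen (FreeProductRel T U) ≤ Con.ker (FreeSemigroup.lift (Sum.elim f g)) := by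
    rw [Con.conGen_le]
    rintro _ _ (⟨t, t'⟩ | ⟨y, y'⟩) <;> rw [Con.ker_rel] <;> simp
  exact key h

/-- The homomorphism from the free product given by homomorphisms on the factors. -/
def lift {M : Type*} [Semigroup M] (f : T →ₙ* M) (g : U →ₙ* M) : FreeProduct T U →ₙ* M where
  toFun s := Con.liftOn s (FreeSemigroup.lift (Sum.elim f g)) fun _ _ => hom_eq_of_rel f g
  map_mul' s s' := by
    induction s, s' using Con.induction_on₂ with
    | _ a b => exact map_mul (FreeSemigroup.lift (Sum.elim f g)) a b

variable (T U) in
/-- The disjoint union of `T`, `U` and a zero `none`, where all mixed products are zero. -/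
def ZeroUnion : Type max u w := Option (T ⊕ U)

instance : Semigroup (ZeroUnion T U) where
  mul
    | some (.inl t), some (.inl t') => some (.inl (t * t'))
    | some (.inr y), some (.inr y') => some (.inr (y * y'))
    | _, _ => none
  mul_assoc := by
    rintro (_ | _ | _) (_ | _ | _) (_ | _ | _) <;>
      first
        | rfl
        | exact congrArg (fun t => some (Sum.inl t)) (mul_assoc _ _ _)
        | exact congrArg (fun y => some (Sum.inr y)) (mul_assoc _ _ _)

variable (T U) in
/-- The projection of the free product that annihilates all mixed words. -/
def toZeroUnion : FreeProduct T U →ₙ* ZeroUnion T U :=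
  lift { toFun := fun t => some (.inl t), map_mul' := fun _ _ => rfl }
    { toFun := fun y => some (.inr y), map_mul' := fun _ _ => rfl }

theorem inl_injective : Function.Injective (inl T U) := fun t t' h => by
  have := congrArg (toZeroUnion T U) h
  exact Sum.inl.inj (Option.some.inj this)

theorem inr_injective : Function.Injective (inr T U) := fun y y' h => by
  have := congrArg (toZeroUnion T U) h
  exact Sum.inr.inj (Option.some.inj this)

theorem inl_ne_inr (t : T) (y : U) : inl T U t ≠ inr T U y := fun h => by
  have := congrArg (toZeroUnion T U) h
  cases Option.some.inj this

variable (T U) in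
/-- The union of the two factors. -/
def factors : Set (FreeProduct T U) := Set.range (inl T U) ∪ Set.range (inr T U)

theorem inl_mem (t : T) : inl T U t ∈ factors T U := .inl ⟨t, rfl⟩

theorem inr_mem (y : U) : inr T U y ∈ factors T U := .inr ⟨y, rfl⟩

theorem notMem_factors_of_eq_none {s : FreeProduct T U} (h : toZeroUnion T U s = none) :
    s ∉ factors T U := by
  rintro (⟨t, rfl⟩ | ⟨y, rfl⟩) <;> cases h

theorem inl_mul_inr_notMem (t : T) (y : U) : inl T U t * inr T U y ∉ factors T U :=
  notMem_factors_of_eq_none (map_mul (toZeroUnion T U) _ _)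

theorem inr_mul_inl_notMem (t : T) (y : U) : inr T U y * inl T U t ∉ factors T U :=
  notMem_factors_of_eq_none (map_mul (toZeroUnion T U) _ _)

/-- A product of two factors from different sides is killed by `toZeroUnion`, so it is never in
`factors`; only the two pure cases remain. -/
theorem overlapClosed_factors : OverlapClosed (factors T U) := by
  rintro _ (⟨x, rfl⟩ | ⟨x, rfl⟩) _ (⟨y, rfl⟩ | ⟨y, rfl⟩) _ (⟨z, rfl⟩ | ⟨z, rfl⟩) hxy hyz
  · rw [← map_mul, ← map_mul]
    exact inl_mem _
  · exact absurd hyz (inl_mul_inr_notMem _ _)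
  · exact absurd hxy (inl_mul_inr_notMem _ _)
  · exact absurd hxy (inl_mul_inr_notMem _ _)
  · exact absurd hxy (inr_mul_inl_notMem _ _)
  · exact absurd hxy (inr_mul_inl_notMem _ _)
  · exact absurd hyz (inr_mul_inl_notMem _ _)
  · rw [← map_mul, ← map_mul]
    exact inr_mem _

theorem evalWord_factors_surjective : Function.Surjective (evalWord (factors T U)) := by
  intro s
  induction s using Con.induction_on with
  | H a =>
    have hof (x : T ⊕ U) : ∃ b, evalWord (factors T U) b =
        ((FreeSemigroup.of x : FreeSemigroup (T ⊕ U)) : FreeProduct T U) := by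
      rcases x with t | y
      · exact ⟨.of ⟨inl T U t, inl_mem t⟩, rfl⟩
      · exact ⟨.of ⟨inr T U y, inr_mem y⟩, rfl⟩
    induction a using FreeSemigroup.recOnMul with
    | ih1 x => exact hof x
    | ih2 x a _ ih =>
      obtain ⟨b, hb⟩ := ih
      obtain ⟨b', hb'⟩ := hof x
      exact ⟨b' * b, by rw [map_mul, hb, hb', Con.coe_mul]⟩

variable (T U) in
theorem exists_isReducedLength_factors :
    ∃ len : FreeProduct T U → ℕ, IsReducedLength (factors T U) len := by
  have hmul {x y z : factors T U} (h : (x : FreeProduct T U) * y = z)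
      (l : List (factors T U)) : push l z = push (push l y) x := by
    have hxy : (x : FreeProduct T U) * y ∈ factors T U := h ▸ z.2
    obtain rfl : z = ⟨(x : FreeProduct T U) * y, hxy⟩ := Subtype.ext h.symm
    exact (push_push overlapClosed_factors hxy l).symm
  let f : T →ₙ* Function.End (List (factors T U)) :=
    { toFun := fun t l => push l ⟨inl T U t, inl_mem t⟩
      map_mul' := fun t t' => funext fun l => hmul (map_mul (inl T U) t t').symm l }
  let g : U →ₙ* Function.End (List (factors T U)) :=
    { toFun := fun y l => push l ⟨inr T U y, inr_mem y⟩
      map_mul' := fun y y' => funext fun l => hmul (map_mul (inr T U) y y').symm l }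
  refine ⟨_, isReducedLength_of_action evalWord_factors_surjective overlapClosed_factors
    (lift f g) ?_⟩
  rintro ⟨_, ⟨t, rfl⟩ | ⟨y, rfl⟩⟩ l <;> rfl

theorem eq_inl_or_eq_inr_of_mem_tuples {n : ℕ} {x : Fin (n + 1) → FreeProduct T U}
    (hx : x ∈ tuples (factors T U) (n + 1)) :
    (∃ t : Fin (n + 1) → T, x = fun i => inl T U (t i)) ∨
      ∃ y : Fin (n + 1) → U, x = fun i => inr T U (y i) := by
  have hmem (i : Fin (n + 1)) : x i ∈ factors T U := hx i 0 i.2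
  have hmul (i : Fin n) : x i.castSucc * x i.succ ∈ factors T U :=
    hx i 1 (Nat.succ_lt_succ i.2)
  rcases hmem 0 with h0 | h0
  · left
    have h (i : Fin (n + 1)) : ∃ t, inl T U t = x i := by
      induction i using Fin.induction with
      | zero => exact h0
      | succ i ih =>
        obtain ⟨t, ht⟩ := ih
        rcases hmem i.succ with h | ⟨y, hy⟩
        · exact h
        · have := hmul i
          rw [← ht, ← hy] at this
          exact absurd this (inl_mul_inr_notMem _ _)
    choose t ht using h
    exact ⟨t, funext fun i => (ht i).symm⟩
  · right
    have h (i : Fin (n + 1)) : ∃ y, inr T U y = x i := by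
      induction i using Fin.induction with
      | zero => exact h0
      | succ i ih =>
        obtain ⟨y, hy⟩ := ih
        rcases hmem i.succ with ⟨t, ht⟩ | h
        · have := hmul i
          rw [← ht, ← hy] at this
          exact absurd this (inr_mul_inl_notMem _ _)
        · exact h
    choose y hy using h
    exact ⟨y, funext fun i => (hy i).symm⟩

theorem map_comp_mem_tuples {S : Type*} [Semigroup S] {R : Type*} [Semigroup R] {W : Set S}
    (φ : R →ₙ* S) (hφ : ∀ r, φ r ∈ W) {n : ℕ} (t : Fin n → R) :
    (fun i => φ (t i)) ∈ tuples W n := by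
  intro i m h
  suffices hseg : segProd (fun i => φ (t i)) i m h = φ (segProd t i m h) from hseg ▸ hφ _
  induction m with
  | zero => rfl
  | succ m ih => simp only [segProd, ih, map_mul]

variable {A : Type v} [AddCommGroup A]

/-- In positive degree, partial cochains on `factors` are pairs of cochains on `T` and `U`. In
degree 0 the empty tuple is shared by both sides. -/
theorem vanishes_on_tuples_iff {n : ℕ} {f : (Fin (n + 1) → FreeProduct T U) → A} :
    (∀ x ∈ tuples (factors T U) (n + 1), f x = 0) ↔
      cochainPullback (inl T U) A (n + 1) f = 0 ∧ cochainPullback (inr T U) A (n + 1) f = 0 := by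
  constructor
  · intro h
    exact ⟨funext fun t => h _ (map_comp_mem_tuples _ inl_mem t),
      funext fun y => h _ (map_comp_mem_tuples _ inr_mem y)⟩
  · rintro ⟨h, h'⟩ x hx
    rcases eq_inl_or_eq_inr_of_mem_tuples hx with ⟨t, rfl⟩ | ⟨y, rfl⟩
    · exact congrFun h t
    · exact congrFun h' y

theorem exists_cochain_of_factors {n : ℕ} (p : (Fin (n + 1) → T) → A)
    (q : (Fin (n + 1) → U) → A) :
    ∃ f : (Fin (n + 1) → FreeProduct T U) → A,
      cochainPullback (inl T U) A (n + 1) f = p ∧ cochainPullback (inr T U) A (n + 1) f = q := by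
  have hl : Function.Injective fun (t : Fin (n + 1) → T) i => inl T U (t i) :=
    inl_injective.comp_left
  have hr : Function.Injective fun (y : Fin (n + 1) → U) i => inr T U (y i) :=
    inr_injective.comp_left
  refine ⟨Function.extend (fun (t : Fin (n + 1) → T) i => inl T U (t i)) p
    (Function.extend (fun (y : Fin (n + 1) → U) i => inr T U (y i)) q 0),
    funext fun t => hl.extend_apply _ _ _, funext fun y => ?_⟩
  refine (Function.extend_apply' _ _ _ ?_).trans (hr.extend_apply _ _ _)
  rintro ⟨t, ht⟩
  -- Positive degree supplies the entry 0, which separates the tuples from `T` and from `U`.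
  exact inl_ne_inr _ _ (congrFun ht 0)

theorem bijective_prod_cohomologyPullback (ρ : FreeProduct T U →ₙ* AddMonoid.End A) {n : ℕ}
    (hn : 2 ≤ n) :
    Function.Bijective ((cohomologyPullback (inl T U) ρ n).prod
      (cohomologyPullback (inr T U) ρ n)) := by
  obtain ⟨n, rfl⟩ := Nat.exists_eq_add_of_le' hn
  obtain ⟨len, hL⟩ := exists_isReducedLength_factors T U
  constructor
  · rw [injective_iff_map_eq_zero]
    intro a
    induction a using QuotientAddGroup.induction_on with
    | H f =>
      intro h
      obtain ⟨h₁, h₂⟩ := Prod.mk.inj h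
      obtain ⟨p, hp⟩ : cochainPullback (inl T U) A (n + 2) f.1 ∈ coboundaries _ (n + 2) :=
        (cohomology_mk_eq_zero_iff _ (cocyclePullback (inl T U) ρ (n + 2) f)).1 h₁
      obtain ⟨q, hq⟩ : cochainPullback (inr T U) A (n + 2) f.1 ∈ coboundaries _ (n + 2) :=
        (cohomology_mk_eq_zero_iff _ (cocyclePullback (inr T U) ρ (n + 2) f)).1 h₂
      obtain ⟨g, rfl, rfl⟩ := exists_cochain_of_factors p q
      rw [← cochainPullback_coboundary] at hp hq
      have hf : coboundary ρ (n + 2) f.1 = 0 := f.2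
      rw [cohomology_mk_eq_zero_iff]
      have h := hL.mem_coboundaries ρ (f := f.1 - coboundary ρ (n + 1) g)
        (by rw [map_sub, hf, coboundary_coboundary, sub_zero])
        (vanishes_on_tuples_iff.2
          ⟨by rw [map_sub, hp, sub_self], by rw [map_sub, hq, sub_self]⟩)
      have h' : coboundary ρ (n + 1) g ∈ coboundaries ρ (n + 2) := ⟨g, rfl⟩
      simpa using add_mem h h'
  · rintro ⟨a, b⟩
    induction a using QuotientAddGroup.induction_on with
    | H p =>
    induction b using QuotientAddGroup.induction_on with
    | H q =>
      obtain ⟨f, hp, hq⟩ := exists_cochain_of_factors p.1 q.1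
      obtain ⟨g, hg, hgf⟩ := hL.exists_relative_primitive ρ (coboundary_coboundary ρ (n + 2) f)
        (vanishes_on_tuples_iff.2
          ⟨by rw [cochainPullback_coboundary, hp]; exact p.2,
            by rw [cochainPullback_coboundary, hq]; exact q.2⟩)
      obtain ⟨hg₁, hg₂⟩ := vanishes_on_tuples_iff.1 hg
      refine ⟨QuotientAddGroup.mk ⟨f - g, ?_⟩, Prod.ext ?_ ?_⟩
      · change coboundary ρ (n + 2) (f - g) = 0
        rw [map_sub, hgf, sub_self]
      · refine congrArg QuotientAddGroup.mk (Subtype.ext ?_)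
        change cochainPullback (inl T U) A (n + 2) (f - g) = p.1
        rw [map_sub, hp, hg₁, sub_zero]
      · refine congrArg QuotientAddGroup.mk (Subtype.ext ?_)
        change cochainPullback (inr T U) A (n + 2) (f - g) = q.1
        rw [map_sub, hq, hg₂, sub_zero]

end FreeProduct

end FreeProduct

end PartialCoh

theorem theorem10 :
    (∀ (S : Type u) [Semigroup S] (W : Set S),
      PartialCoh.IsRoot W → PartialCoh.IsCanonic W → PartialCoh.IsJ W →
      ∀ (A : Type v) [AddCommGroup A] (ρ : S →ₙ* AddMonoid.End A) (n : ℕ),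
        Function.Bijective (PartialCoh.theta W ρ n)) ∧
    (∀ (T : Type u) (U : Type w) [Semigroup T] [Semigroup U]
      (A : Type v) [AddCommGroup A]
      (ρ : PartialCoh.FreeProduct T U →ₙ* AddMonoid.End A) (n : ℕ), 2 ≤ n →
        Function.Bijective
          ((PartialCoh.cohomologyPullback (PartialCoh.FreeProduct.inl T U) ρ n).prod
            (PartialCoh.cohomologyPullback (PartialCoh.FreeProduct.inr T U) ρ n))) := by
  refine ⟨fun S _ W hR hC hJ A _ ρ n => ?_, fun T U _ _ A _ ρ n hn =>
    PartialCoh.FreeProduct.bijective_prod_cohomologyPullback ρ hn⟩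
  obtain ⟨len, hL⟩ := PartialCoh.exists_isReducedLength_of_isRoot hR
    (PartialCoh.overlapClosed_of_isCanonic_of_isJ hC hJ)
  exact hL.bijective_theta ρ n
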